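/- There are finite sets of students $\mathcal S$, districts $\mathcal D$, schools $\mathcal C$ and types $\mathcal T$. Students and schools $x$ have home districts $d(x)$, student $s$ has type $\tau(s)$, and school $c$ has capacity $q_c$; $k_d$ is the number of students from district $d$. A contract is a triple $(s,d,c)$ with $d(c)=d$, and a matching is a set of contracts. A matching is feasible if every student has at most one contract in it and every school $c$ at most $q_c$. A feasible initial matching $\tilde X$, in which every student has exactly one contract, is given. Every student $s$ has a strict preference order $P_s$ over the schools and being unmatched, which is the worst outcome. A distribution is a vector $\xi=(\xi_c^t)\in\mathbb Z_+^{\mathcal C\times\mathcal T}$; $\xi(X)$ denotes the numbers of type-$t$ students at school $c$ in $X$; $\chi_{c,t}$ is a unit vector. A matching $X$ satisfies a set of distributions $\Xi$ if $\xi(X)\in\Xi$. Let $\Xi^0=\{\xi\mid \sum_{c,t}\xi_c^t=\sum_d k_d,\ \sum_t\xi_c^t\le q_c\text{ for all }c\}$. A set $\Xi$ of distributions is M-convex if, whenever $\xi,\tilde\xi\in\Xi$ and $\xi_c^t>\tilde\xi_c^t$, there are $c',t'$ with $\xi_{c'}^{t'}<\tilde\xi_{c'}^{t'}$ such that $\xi-\chi_{c,t}+\chi_{c',t'}\in\Xi$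 and $\tilde\xi+\chi_{c,t}-\chi_{c',t'}\in\Xi$. The top trading cycles mechanism (TTC) for a policy $\Xi$ and a strict master priority list of students runs as follows. The initial pair of student $s$ is $(c_0,\tau(s))$, where $c_0$ is her school in $\tilde X$. Student $s$ ranks school-type pairs by a strict order $\tilde P_s$, formed from $P_s$, that orders the pairs $(c,\tau(s))$ as $P_s$ orders the schools $c$, and ranks her initial pair above every pair with a type other than $\tau(s)$. Each pair $(c,t)$ gives the highest priority to the students whose initial pair it is, and ties are broken by the master list. At each step let $\xi$ be the distribution in which the students assigned in earlier steps have their assigned pairs and the others their initial pairs. An unassigned student with initial pair $(c,t)$ is permissible to $(c',t')$ if $\xi+\chi_{c',t'}-\chi_{c,t}\in\Xi\cap\Xi^0$. Pairs with no permissible unassigned student are removed for good; each remaining pair points to its permissible unassigned student of highest priority, and each unassigned student points to her highest ranked remaining pair with respect to $\tilde P_s$. Every student on a cycle is assigned the pair she points to and leaves. The outcome matches every student with the school of her assigned pair. Let $p_c^t,q_c^t\in\mathbb Z_+$ be floors and ceilings, and let $\Xi=\{\xi\mid p_c^t\le\xi_c^t\le q_c^t\text{ for all }c,t\}$ be the school-level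 diversity policy. Then $\Xi\cap\Xi^0$ is M-convex. Suppose moreover that $\tilde X$ satisfies $\Xi$. Then, for every master priority list and every choice of the orders $\tilde P_s$ as above, TTC for $\Xi$ produces a feasible matching at every preference profile and satisfies: 1. the policy: its outcome satisfies $\Xi$ at every profile; 2. constrained efficiency: at every profile, no feasible matching that satisfies $\Xi$ Pareto dominates the outcome (every student weakly better off, at least one strictly); 3. individual rationality: at every profile, every student weakly prefers her outcome to her initial school; 4. strategy-proofness: no student can ever get an outcome that she strictly prefers by reporting another preference order. -/

import Mathlib

/-- A strict (complete, transitive) preference or priority order on `α`;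
`r.rel a b` means that `a` is ranked strictly above `b`. -/
structure StrictRanking (α : Type*) where
  rel : α → α → Prop
  irrefl : ∀ a, ¬ rel a a
  trans : ∀ a b c, rel a b → rel b c → rel a c
  total : ∀ a b, a ≠ b → rel a b ∨ rel b a

/-- The weak order of a strict ranking. -/
def StrictRanking.weak {α : Type*} (r : StrictRanking α) (a b : α) : Prop :=
  r.rel a b ∨ a = b

namespace SchoolChoice

/-- A contract `(s, d, c)` with `d(c) = d`. -/
structure Contract (S : Type*) {D C : Type*} (homeC : C → D) where
  student : S
  district : D
  school : C
  home_eq : homeC school = district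

/-- A matching is a set of contracts. -/
abbrev Matching (S : Type*) {D C : Type*} (homeC : C → D) := Set (Contract S homeC)

/-- At most one contract is associated with every student. -/
def FeasibleForStudents {S D C : Type*} {homeC : C → D} (X : Matching S homeC) : Prop :=
  ∀ x ∈ X, ∀ y ∈ X, x.student = y.student → x = y

/-- Feasible for students, and no school has more contracts than its capacity. -/
def Feasible {S D C : Type*} {homeC : C → D} (cap : C → ℕ) (X : Matching S homeC) : Prop :=
  FeasibleForStudents X ∧ ∀ c, {x ∈ X | x.school = c}.ncard ≤ cap c

/-- The data of a problem other than the student preferences: home districts of students and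
schools, student types, school capacities, and a feasible initial matching in which every student
has exactly one contract. -/
structure Problem (S D C T : Type*) where
  homeS : S → D
  homeC : C → D
  type : S → T
  cap : C → ℕ
  initial : Matching S homeC
  initial_feasible : Feasible cap initial
  initial_matched : ∀ s, ∃! x, x ∈ initial ∧ x.student = s

/-- A student's strict preference order over the schools (`some c`) and the outside option
(`none`), the outside option being the least preferred outcome. -/
structure Preference (C : Type*) extends StrictRanking (Option C) where
  outside_worst : ∀ c, rel (some c) none

/-- A distribution: the entry at `(c, t)` is the number of type-`t` students at school `c`. -/
abbrev Distribution (C T : Type*) := C × T → ℕ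

open Classical in
/-- The distribution with one type-`t` student at school `c`, for `a = (c, t)`, and no other
student. -/
noncomputable def unitDist {C T : Type*} (a : C × T) : Distribution C T := Pi.single a 1

/-- The vector `ξ - χ_a + χ_b` belongs to `Ξ`. It is written additively because subtraction of
natural numbers truncates. -/
def ExchangeMem {C T : Type*} (Ξ : Set (Distribution C T)) (ξ : Distribution C T)
    (a b : C × T) : Prop :=
  ∃ η ∈ Ξ, η + unitDist a = ξ + unitDist b

/-- M-convexity of a set of distributions. -/
def MConvex {C T : Type*} (Ξ : Set (Distribution C T)) : Prop :=
  ∀ ξ ∈ Ξ, ∀ ξ' ∈ Ξ, ∀ a, ξ' a < ξ a →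
    ∃ b, ξ b < ξ' b ∧ ExchangeMem Ξ ξ a b ∧ ExchangeMem Ξ ξ' b a

/-- The school-level diversity policy with floors `p` and ceilings `q`. -/
def schoolLevelPolicy {C T : Type*} (p q : C → T → ℕ) : Set (Distribution C T) :=
  {ξ | ∀ c t, p c t ≤ ξ (c, t) ∧ ξ (c, t) ≤ q c t}

namespace Problem

variable {S D C T : Type*} (Pb : Problem S D C T)

/-- The number `k_d` of students whose home district is `d`. -/
noncomputable def districtSize (d : D) : ℕ := {s | Pb.homeS s = d}.ncard

/-- The policy `Ξ⁰` that each student is matched and no school exceeds its capacity. -/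
def fullMatchPolicy [Fintype D] [Fintype C] [Fintype T] : Set (Distribution C T) :=
  {ξ | ∑ a, ξ a = ∑ d, Pb.districtSize d ∧ ∀ c, ∑ t, ξ (c, t) ≤ Pb.cap c}

/-- The distribution associated with a matching. -/
noncomputable def dist (X : Matching S Pb.homeC) : Distribution C T := fun a =>
  {x ∈ X | x.school = a.1 ∧ Pb.type x.student = a.2}.ncard

/-- The matching satisfies the policy goal `Ξ`. -/
def SatisfiesGoal (Ξ : Set (Distribution C T)) (X : Matching S Pb.homeC) : Prop :=
  Pb.dist X ∈ Ξ

open Classical in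
/-- The school that `s` attends at a matching feasible for students (`none` if unmatched). -/
noncomputable def outcome (X : Matching S Pb.homeC) (s : S) : Option C :=
  if h : ∃ x ∈ X, x.student = s then some h.choose.school else none

/-- Every student weakly prefers her outcome to her initial school. -/
def IndividuallyRational (P : S → Preference C) (X : Matching S Pb.homeC) : Prop :=
  ∀ s, (P s).weak (Pb.outcome X s) (Pb.outcome Pb.initial s)

/-- `X` Pareto dominates `Y`. -/
def ParetoDominates (P : S → Preference C) (X Y : Matching S Pb.homeC) : Prop :=
  (∀ s, (P s).weak (Pb.outcome X s) (Pb.outcome Y s)) ∧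
    ∃ s, (P s).rel (Pb.outcome X s) (Pb.outcome Y s)

/-- `X` is feasible, satisfies `Ξ`, and no feasible matching satisfying `Ξ` Pareto dominates it. -/
def ConstrainedEfficient (Ξ : Set (Distribution C T)) (P : S → Preference C)
    (X : Matching S Pb.homeC) : Prop :=
  Feasible Pb.cap X ∧ Pb.SatisfiesGoal Ξ X ∧
    ¬ ∃ Y : Matching S Pb.homeC,
      Feasible Pb.cap Y ∧ Pb.SatisfiesGoal Ξ Y ∧ Pb.ParetoDominates P Y X

/-- A mechanism: a feasible matching for each preference profile. -/
def IsMechanism (φ : (S → Preference C) → Matching S Pb.homeC) : Prop :=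
  ∀ P, Feasible Pb.cap (φ P)

open Classical in
/-- No student can misreport and get a strictly preferred outcome. -/
def StrategyProof (φ : (S → Preference C) → Matching S Pb.homeC) : Prop :=
  ∀ (P : S → Preference C) (s : S) (P' : Preference C),
    ¬ (P s).rel (Pb.outcome (φ (Function.update P s P')) s) (Pb.outcome (φ P) s)

/-- The initial school of a student. -/
noncomputable def initialSchool (s : S) : C := (Pb.initial_matched s).choose.school

/-- The initial school-type pair of a student in the hypothetical problem. -/
noncomputable def initialPair (s : S) : C × T := (Pb.initialSchool s, Pb.type s)

/-- `Q` is a preference order of student `s` over school-type pairs in the hypothetical problem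
that is derived from her preference order `P`. -/
def IsHypothetical (s : S) (P : Preference C) (Q : StrictRanking (C × T)) : Prop :=
  (∀ c c', P.rel (some c) (some c') ↔ Q.rel (c, Pb.type s) (c', Pb.type s)) ∧
    ∀ c t, t ≠ Pb.type s → Q.rel (Pb.initialPair s) (c, t)

/-- `s` has higher priority than `s'` at the school-type pair `a`: students initially matched with
`a` come first, and ties are broken by the master priority list. -/
def Priority (master : StrictRanking S) (a : C × T) (s s' : S) : Prop :=
  (Pb.initialPair s = a ∧ Pb.initialPair s' ≠ a) ∨
    ((Pb.initialPair s = a ↔ Pb.initialPair s' = a) ∧ master.rel s s')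

end Problem

/-- The state of the top trading cycles algorithm at the beginning of a step: the school-type pairs
assigned so far (`none` for a student still in the market) and the pairs removed so far. -/
structure TTCState (S C T : Type*) where
  assigned : S → Option (C × T)
  removed : Set (C × T)

namespace Problem

section TTC

variable {S D C T : Type*} (Pb : Problem S D C T) (Ξ : Set (Distribution C T))
  (master : StrictRanking S) (Q : S → StrictRanking (C × T)) (st : TTCState S C T)

/-- The matching `X^n` of the hypothetical problem: assignments of the previous steps, and initial
assignments for the students not yet processed. -/
noncomputable def currentPair (s : S) : C × T := (st.assigned s).getD (Pb.initialPair s)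

/-- The distribution of `X^n`. -/
noncomputable def currentDist : Distribution C T := fun a => {s | Pb.currentPair st s = a}.ncard

/-- Student `s` is permissible to the pair `a` at `X^n`. -/
def Permissible (s : S) (a : C × T) : Prop :=
  ExchangeMem Ξ (Pb.currentDist st) (Pb.initialPair s) a

/-- Student `s` is unassigned, and permissible to the pair `a` at `X^n`. -/
def Candidate (s : S) (a : C × T) : Prop :=
  st.assigned s = none ∧ Pb.Permissible Ξ st s a

/-- The pair `a` is in the market after the pairs without candidates have been removed. -/
def Remaining (a : C × T) : Prop :=
  a ∉ st.removed ∧ ∃ s, Pb.Candidate Ξ st s a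

/-- The remaining pair `a` points to its candidate `s` of highest priority. -/
def PairPoints (a : C × T) (s : S) : Prop :=
  Pb.Remaining Ξ st a ∧ Pb.Candidate Ξ st s a ∧
    ∀ s', Pb.Candidate Ξ st s' a → s' ≠ s → Pb.Priority master a s s'

/-- The unassigned student `s` points to her highest ranked remaining pair `a`. -/
def StudentPoints (s : S) (a : C × T) : Prop :=
  st.assigned s = none ∧ Pb.Remaining Ξ st a ∧
    ∀ b, Pb.Remaining Ξ st b → b ≠ a → (Q s).rel a b

/-- Student `s` lies on a cycle of the pointing graph. -/
def OnCycle (s : S) : Prop :=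
  Relation.TransGen
    (fun s₁ s₂ => ∃ a, Pb.StudentPoints Ξ Q st s₁ a ∧ Pb.PairPoints Ξ master st a s₂) s s

open Classical in
/-- One step of the algorithm: pairs without candidates are removed, and every student on a cycle
is assigned the pair she is pointing to. -/
noncomputable def ttcStep : TTCState S C T where
  assigned s :=
    if h : Pb.OnCycle Ξ master Q st s ∧ ∃ a, Pb.StudentPoints Ξ Q st s a then some h.2.choose
    else st.assigned s
  removed := st.removed ∪ {a | ¬ ∃ s, Pb.Candidate Ξ st s a}

/-- The state after `n` steps; initially nothing is assigned or removed. -/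
noncomputable def ttcRun (n : ℕ) : TTCState S C T :=
  (Pb.ttcStep Ξ master Q)^[n] ⟨fun _ => none, ∅⟩

/-- The matching induced by the outcome of the algorithm: student `s` is matched with the school of
the pair that she is assigned at some step. -/
def ttcMatching : Matching S Pb.homeC :=
  {x | ∃ n t, (Pb.ttcRun Ξ master Q n).assigned x.student = some (x.school, t)}

/-- The top trading cycles mechanism. Permissibility is membership of the resulting distribution in
`Ξ`, and `hyp s P` is the preference order over school-type pairs in the hypothetical problem that
is formed from the report `P` of student `s`. -/
def ttc (hyp : S → Preference C → StrictRanking (C × T)) :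
    (S → Preference C) → Matching S Pb.homeC :=
  fun P => Pb.ttcMatching Ξ master (fun s => hyp s (P s))

end TTC

end Problem

end SchoolChoice

/-!
Only the distribution of students over school-type pairs matters for the policy. Moving one student
from a pair `a` to another pair `b` keeps a distribution in the policy iff `a` is above its floor,
`b` is below its ceiling, and `a` and `b` are at the same school or the school of `b` has a free
seat. M-convexity follows by exchanging within a school if possible, and otherwise with a school
that has fewer students than in the other distribution.

A pair with an unassigned owner (a student whose initial pair it is) points to an owner. A pair
without one points to the top student of the master list among those who can be moved to it. Hence
two pairs without owners point to the same student as soon as each could accept the student of the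
other (`PairPoints.eq_of_cross`). Consequently, among the trades of one step that are not with an
owner, no two draw from the same pair or enter the same school with a free seat, while a full
school takes a student only in exchange for one of its own. So each step preserves the policy
(`ttcStep_mem`). The same comparison shows that a pair keeps pointing to the same student until
she leaves (`PairPoints.ttcStep`).

M-convexity shows that a pair without candidates is out of reach for the unassigned students in
every assignment in the policy that keeps the trades already made (`ne_of_no_candidate`). Thus
removing it loses nothing, and constrained efficiency follows by looking at the first student to
trade whose school differs in a dominating matching. For strategy-proofness, the runs under two
reports of a student coincide until she trades in one of them. If the misreport makes her trade
earlier, the chain of pointing from the pair she would get back to her stays in place, by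
persistence, until she trades under the truthful report, and the pair is still available then
(`remaining_of_tradesAt`).
-/

open Relation

/-! ### Finite rankings and functional relations -/

namespace StrictRanking

variable {α : Type*} (r : StrictRanking α)

lemma asymm {a b : α} (hab : r.rel a b) (hba : r.rel b a) : False :=
  r.irrefl a (r.trans a b a hab hba)

lemma exists_top [Finite α] {A : Set α} (hA : A.Nonempty) :
    ∃ a ∈ A, ∀ b ∈ A, b ≠ a → r.rel a b := by
  have : IsTrans α r.rel := ⟨r.trans⟩
  have : Std.Irrefl r.rel := ⟨r.irrefl⟩
  obtain ⟨a, ha, hmin⟩ := (Finite.wellFounded_of_trans_of_irrefl r.rel).has_min A hA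
  refine ⟨a, ha, fun b hb hne => ?_⟩
  exact (r.total b a hne).resolve_left (hmin b hb)

end StrictRanking

namespace SchoolChoice

section Relations

variable {α : Type*} {R : α → α → Prop}

/-- A finite set in which every element has a successor contains a cycle. -/
lemma exists_transGen_self [Finite α] {U : Set α} (hU : U.Nonempty)
    (h : ∀ x ∈ U, ∃ y ∈ U, R x y) : ∃ x, TransGen R x x := by
  by_contra hno
  push Not at hno
  have : IsTrans α (fun x y => TransGen R y x) := ⟨fun _ _ _ h₁ h₂ => h₂.trans h₁⟩
  have : Std.Irrefl (fun x y => TransGen R y x) := ⟨hno⟩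
  obtain ⟨x, hx, hmin⟩ :=
    (Finite.wellFounded_of_trans_of_irrefl (fun x y => TransGen R y x)).has_min U hU
  obtain ⟨y, hy, hxy⟩ := h x hx
  exact hmin y hy (TransGen.single hxy)

lemma transGen_self_of_step (hR : ∀ x y z, R x y → R x z → y = z) {x y : α}
    (hx : TransGen R x x) (hxy : R x y) : TransGen R y y := by
  obtain ⟨z, hxz, hzx⟩ := TransGen.head'_iff.1 hx
  obtain rfl := hR x y z hxy hxz
  exact TransGen.tail' hzx hxy

lemma transGen_self_of_reflTransGen (hR : ∀ x y z, R x y → R x z → y = z) {x y : α}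
    (hx : TransGen R x x) (hxy : ReflTransGen R x y) : TransGen R y y := by
  induction hxy with
  | refl => exact hx
  | tail _ h ih => exact transGen_self_of_step hR ih h

/-- In a finite functional graph, moving along the cycles and fixing everything else is a
permutation. -/
lemma exists_perm_cycles [Finite α] (hR : ∀ x y z, R x y → R x z → y = z) :
    ∃ σ : Equiv.Perm α, ∀ x,
      (TransGen R x x → R x (σ x)) ∧ (¬ TransGen R x x → σ x = x) := by
  classical
  have hsucc : ∀ x, ∃ y, (TransGen R x x → R x y) ∧ (¬ TransGen R x x → y = x) := by
    intro x
    by_cases hx : TransGen R x x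
    · obtain ⟨y, hy, -⟩ := TransGen.head'_iff.1 hx
      exact ⟨y, fun _ => hy, fun h => absurd hx h⟩
    · exact ⟨x, fun h => absurd h hx, fun _ => rfl⟩
  choose f hf hf' using hsucc
  have hsurj : Function.Surjective f := by
    intro y
    by_cases hy : TransGen R y y
    · obtain ⟨x, hyx, hxy⟩ := TransGen.tail'_iff.1 hy
      have hx : TransGen R x x := TransGen.head' hxy hyx
      exact ⟨x, hR x _ _ (hf x hx) hxy⟩
    · exact ⟨y, hf' y hy⟩
  exact ⟨Equiv.ofBijective f (Finite.surjective_iff_bijective.1 hsurj), fun x => ⟨hf x, hf' x⟩⟩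

lemma reflTransGen_of_avoid {R' : α → α → Prop} {s x : α}
    (h : ∀ x y, x ≠ s → R x y → R' x y) (hx : ReflTransGen R x s) : ReflTransGen R' x s := by
  induction hx using ReflTransGen.head_induction_on with
  | refl => exact ReflTransGen.refl
  | @head x y hxy _ ih =>
    by_cases hs : x = s
    · exact hs ▸ ReflTransGen.refl
    · exact ReflTransGen.head (h _ _ hs hxy) ih

lemma transGen_of_avoid {R' : α → α → Prop} {s x y : α}
    (h : ∀ x y, x ≠ s → R x y → R' x y) (hxs : ∀ z, ReflTransGen R x z → z ≠ s)
    (hxy : TransGen R x y) : TransGen R' x y := by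
  induction hxy with
  | single h₁ => exact TransGen.single (h _ _ (hxs _ ReflTransGen.refl) h₁)
  | tail h₁ h₂ ih => exact ih.tail (h _ _ (hxs _ h₁.to_reflTransGen) h₂)

end Relations

/-! ### Counting students -/

section Counting

variable {S C T : Type*}

lemma unitDist_self (a : C × T) : unitDist a a = 1 := by simp [unitDist]

lemma unitDist_of_ne {a b : C × T} (h : b ≠ a) : unitDist a b = 0 := by simp [unitDist, h]

lemma sum_unitDist [Fintype C] [Fintype T] (a : C × T) : ∑ b, unitDist a b = 1 := by
  classical
  rw [Finset.sum_eq_single a (fun b _ h => unitDist_of_ne h) (by simp), unitDist_self]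

open Classical in
lemma sum_school_unitDist [Fintype T] (a : C × T) (c : C) :
    ∑ t, unitDist a (c, t) = if a.1 = c then 1 else 0 := by
  obtain ⟨c', t'⟩ := a
  split_ifs with h
  · obtain rfl : c' = c := h
    rw [Finset.sum_eq_single t', unitDist_self]
    · intro t _ ht
      exact unitDist_of_ne (by simpa using ht)
    · simp
  · exact Finset.sum_eq_zero fun t _ =>
      unitDist_of_ne fun h' => h (congrArg Prod.fst h').symm

/-- The distribution of an assignment of school-type pairs to students. -/
noncomputable def count (f : S → C × T) : Distribution C T := fun a => {s | f s = a}.ncard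

lemma count_eq_sum [Fintype S] (f : S → C × T) : count f = ∑ s, unitDist (f s) := by
  classical
  funext a
  rw [Finset.sum_apply, count, Set.ncard_eq_toFinset_card', Set.toFinset_ofPred,
    Finset.card_filter]
  refine Finset.sum_congr rfl fun s _ => ?_
  split_ifs with h
  · rw [h, unitDist_self]
  · rw [unitDist_of_ne (Ne.symm h)]

lemma sum_count [Fintype S] [Fintype C] [Fintype T] (f : S → C × T) :
    ∑ a, count f a = Fintype.card S := by
  simp only [count_eq_sum, Finset.sum_apply]
  rw [Finset.sum_comm]
  simp [sum_unitDist]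

lemma sum_school_count [Fintype S] [Fintype T] (f : S → C × T) (c : C) :
    ∑ t, count f (c, t) = {s | (f s).1 = c}.ncard := by
  classical
  simp only [count_eq_sum, Finset.sum_apply]
  rw [Finset.sum_comm, Set.ncard_eq_toFinset_card', Set.toFinset_ofPred, Finset.card_filter]
  exact Finset.sum_congr rfl fun s _ => by rw [sum_school_unitDist]

lemma count_update [Fintype S] [DecidableEq S] (f : S → C × T) (s : S) (b : C × T) :
    count (Function.update f s b) + unitDist (f s) = count f + unitDist b := by
  rw [count_eq_sum, count_eq_sum, ← Finset.add_sum_erase _ _ (Finset.mem_univ s),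
    ← Finset.add_sum_erase _ (fun u => unitDist (f u)) (Finset.mem_univ s),
    Function.update_self]
  have : ∑ x ∈ Finset.univ.erase s, unitDist (Function.update f s b x) =
      ∑ x ∈ Finset.univ.erase s, unitDist (f x) :=
    Finset.sum_congr rfl fun x hx => by rw [Function.update_of_ne (Finset.ne_of_mem_erase hx)]
  rw [this]
  abel

lemma ncard_le_of_imp [Finite S] {A B : S → Prop} (h : ∀ s, A s → B s) :
    {s | A s}.ncard ≤ {s | B s}.ncard :=
  Set.ncard_le_ncard h (Set.toFinite _)

lemma ncard_le_succ [Finite S] {A B : S → Prop}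
    (h : ∀ s s', A s → ¬ B s → A s' → ¬ B s' → s = s') :
    {s | A s}.ncard ≤ {s | B s}.ncard + 1 := by
  by_cases hx : ∃ x, A x ∧ ¬ B x
  · obtain ⟨x, hA, hB⟩ := hx
    refine (Set.ncard_le_ncard (t := insert x {s | B s}) ?_ (Set.toFinite _)).trans
      (Set.ncard_insert_le _ _)
    intro s hs
    by_cases hBs : B s
    · exact Or.inr hBs
    · exact Or.inl (h s x hs hBs hA hB)
  · push Not at hx
    exact (ncard_le_of_imp hx).trans (Nat.le_succ _)

lemma exists_of_ncard_lt [Finite S] {A B : S → Prop} (h : {s | B s}.ncard < {s | A s}.ncard) :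
    ∃ s, A s ∧ ¬ B s := by
  by_contra! hno
  exact absurd (ncard_le_of_imp hno) (not_le.2 h)

lemma ncard_perm (σ : Equiv.Perm S) (A : S → Prop) :
    {s | A (σ s)}.ncard = {s | A s}.ncard := by
  have : {s | A s} = σ '' {s | A (σ s)} := by
    ext s
    simp only [Set.mem_ofPred_eq, Set.mem_image]
    exact ⟨fun h => ⟨σ.symm s, by simpa using h, by simp⟩, by rintro ⟨x, hx, rfl⟩; exact hx⟩
  rw [this, Set.ncard_image_of_injective _ σ.injective]

end Counting

/-! ### Exchanges in the school-level diversity policy -/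

namespace Problem

variable {S D C T : Type*}

/-- The school-level diversity policy with floors `p` and ceilings `q`, together with full
matching and the school capacities. -/
abbrev target (Pb : Problem S D C T) [Fintype D] [Fintype C] [Fintype T]
    (p q : C → T → ℕ) : Set (Distribution C T) :=
  schoolLevelPolicy p q ∩ Pb.fullMatchPolicy

lemma sum_districtSize (Pb : Problem S D C T) [Fintype S] [Fintype D] :
    ∑ d, Pb.districtSize d = Fintype.card S := by
  classical
  simp only [districtSize, Set.ncard_eq_toFinset_card', Set.toFinset_ofPred]
  rw [← Finset.card_univ, Finset.card_eq_sum_card_fiberwise (f := Pb.homeS)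
    (s := Finset.univ) (t := Finset.univ) (fun _ _ => by simp)]

section Exchange

lemma exchangeMem_self {Ξ : Set (Distribution C T)} {ξ : Distribution C T} (hξ : ξ ∈ Ξ)
    (a : C × T) : ExchangeMem Ξ ξ a a := ⟨ξ, hξ, rfl⟩

variable {Pb : Problem S D C T} [Fintype D] [Fintype C] [Fintype T] {p q : C → T → ℕ}

lemma exchangeMem_target {ξ : Distribution C T} (hξ : ξ ∈ Pb.target p q) {a b : C × T}
    (hab : a ≠ b) (hp : p a.1 a.2 < ξ a) (hq : ξ b < q b.1 b.2)
    (hc : a.1 = b.1 ∨ ∑ t, ξ (b.1, t) < Pb.cap b.1) : ExchangeMem (Pb.target p q) ξ a b := by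
  classical
  obtain ⟨hpq, hsum, hcap⟩ := hξ
  have heq : (fun x => ξ x + unitDist b x - unitDist a x) + unitDist a = ξ + unitDist b := by
    funext x
    by_cases hx : x = a
    · subst hx
      simp only [Pi.add_apply, unitDist_self]
      omega
    · simp [unitDist_of_ne hx]
  refine ⟨_, ⟨fun c t => ?_, ?_, fun c => ?_⟩, heq⟩
  · have h := hpq c t
    by_cases ha : (c, t) = a
    · subst ha
      simp only [unitDist_self, unitDist_of_ne hab] at *
      omega
    · by_cases hb : (c, t) = b
      · subst hb
        simp only [unitDist_self, unitDist_of_ne ha] at *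
        omega
      · simp only [unitDist_of_ne ha, unitDist_of_ne hb]
        omega
  · have h := congrArg (fun η : Distribution C T => ∑ x, η x) heq
    simp only [Pi.add_apply, Finset.sum_add_distrib, sum_unitDist] at h
    omega
  · have h := congrArg (fun η : Distribution C T => ∑ t, η (c, t)) heq
    simp only [Pi.add_apply, Finset.sum_add_distrib, sum_school_unitDist] at h
    have hc' := hcap c
    by_cases hb : b.1 = c
    · subst hb
      rw [if_pos rfl] at h
      split_ifs at h with ha
      · omega
      · have := hc.resolve_left ha
        omega
    · rw [if_neg hb] at h
      omega

lemma of_exchangeMem_target {ξ : Distribution C T} {a b : C × T} (hab : a ≠ b)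
    (h : ExchangeMem (Pb.target p q) ξ a b) :
    p a.1 a.2 < ξ a ∧ ξ b < q b.1 b.2 ∧ (a.1 = b.1 ∨ ∑ t, ξ (b.1, t) < Pb.cap b.1) := by
  classical
  obtain ⟨η, ⟨hpq, -, hcap⟩, heq⟩ := h
  have ha := congrFun heq a
  have hb := congrFun heq b
  simp only [Pi.add_apply, unitDist_self, unitDist_of_ne hab, unitDist_of_ne hab.symm] at ha hb
  have hpa := hpq a.1 a.2
  have hqb := hpq b.1 b.2
  simp only [Prod.mk.eta] at hpa hqb
  refine ⟨by omega, by omega, ?_⟩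
  by_cases hab' : a.1 = b.1
  · exact Or.inl hab'
  · have h := congrArg (fun η : Distribution C T => ∑ t, η (b.1, t)) heq
    simp only [Pi.add_apply, Finset.sum_add_distrib, sum_school_unitDist, if_neg hab',
      if_pos] at h
    have := hcap b.1
    right
    omega

lemma mConvex_target : MConvex (Pb.target p q) := by
  rintro ξ hξ ξ' hξ' ⟨c, t⟩ hlt
  have H : ∀ b : C × T, ξ b < ξ' b →
      (c = b.1 ∨ (∑ t, ξ (b.1, t) < ∑ t, ξ' (b.1, t)) ∧ ∑ t, ξ' (c, t) < ∑ t, ξ (c, t)) →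
      ∃ b, ξ b < ξ' b ∧ ExchangeMem (Pb.target p q) ξ (c, t) b ∧
        ExchangeMem (Pb.target p q) ξ' b (c, t) := by
    intro b hb hor
    have hne : (c, t) ≠ b := by
      rintro rfl
      omega
    refine ⟨b, hb, exchangeMem_target hξ hne ?_ ?_ ?_, exchangeMem_target hξ' hne.symm ?_ ?_ ?_⟩
    · exact (hξ'.1 c t).1.trans_lt hlt
    · exact hb.trans_le (hξ'.1 b.1 b.2).2
    · exact hor.imp id fun h => h.1.trans_le (hξ'.2.2 b.1)
    · exact (hξ.1 b.1 b.2).1.trans_lt hb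
    · exact hlt.trans_le (hξ.1 c t).2
    · exact hor.imp Eq.symm fun h => h.2.trans_le (hξ.2.2 c)
  by_cases h : ∃ t', ξ (c, t') < ξ' (c, t')
  · obtain ⟨t', ht'⟩ := h
    exact H (c, t') ht' (Or.inl rfl)
  · push Not at h
    have hc : ∑ t, ξ' (c, t) < ∑ t, ξ (c, t) :=
      Finset.sum_lt_sum (fun t _ => h t) ⟨t, Finset.mem_univ t, hlt⟩
    -- The totals agree, so a loss at the school `c` is made up at another school.
    obtain ⟨c', hc'⟩ : ∃ c', ∑ t, ξ (c', t) < ∑ t, ξ' (c', t) := by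
      by_contra! hno
      have := Finset.sum_lt_sum (fun c _ => hno c) ⟨c, Finset.mem_univ c, hc⟩
      rw [← Fintype.sum_prod_type, ← Fintype.sum_prod_type, hξ.2.1, hξ'.2.1] at this
      exact lt_irrefl _ this
    obtain ⟨t', -, ht'⟩ := Finset.exists_lt_of_sum_lt hc'
    exact H (c', t') ht' (Or.inr ⟨hc', hc⟩)

lemma count_mem_target_iff [Fintype S] {f : S → C × T} :
    count f ∈ Pb.target p q ↔
      (∀ c t, p c t ≤ count f (c, t) ∧ count f (c, t) ≤ q c t) ∧
        ∀ c, {s | (f s).1 = c}.ncard ≤ Pb.cap c := by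
  simp only [← sum_school_count]
  refine and_congr_right fun _ => ⟨fun h => h.2, fun h => ⟨?_, h⟩⟩
  rw [sum_count, sum_districtSize]

end Exchange

/-! ### Matchings in which every student is assigned -/

section Matchings

variable {Pb : Problem S D C T}

/-- The matching `X` consists of the contracts between each student `s` and the school `ν s`. -/
def Assigns (X : Matching S Pb.homeC) (ν : S → C) : Prop :=
  ∀ x, x ∈ X ↔ ν x.student = x.school

lemma contract_ext {homeC : C → D} {x y : Contract S homeC} (hs : x.student = y.student)
    (hc : x.school = y.school) : x = y := by
  obtain ⟨s, d, c, h⟩ := x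
  obtain ⟨s', d', c', h'⟩ := y
  obtain rfl : s = s' := hs
  obtain rfl : c = c' := hc
  obtain rfl := h
  obtain rfl := h'
  rfl

lemma exists_assigns {X : Matching S Pb.homeC} (hX : FeasibleForStudents X)
    (h : ∀ s, ∃ x ∈ X, x.student = s) : ∃ ν : S → C, Assigns X ν := by
  choose f hf hfs using h
  refine ⟨fun s => (f s).school, fun x => ⟨fun hx => ?_, fun hx => ?_⟩⟩
  · exact congrArg Contract.school (hX _ (hf x.student) x hx (hfs _))
  · rw [← contract_ext (hfs x.student) hx]
    exact hf _

namespace Assigns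

variable {X : Matching S Pb.homeC} {ν : S → C} (h : Assigns X ν)

lemma feasibleForStudents (h : Assigns X ν) : FeasibleForStudents X := fun x hx y hy hxy =>
  contract_ext hxy (by rw [← (h x).1 hx, ← (h y).1 hy, hxy])

lemma outcome_eq (h : Assigns X ν) (s : S) : Pb.outcome X s = some (ν s) := by
  have hex : ∃ x ∈ X, x.student = s := ⟨⟨s, _, ν s, rfl⟩, (h _).2 rfl, rfl⟩
  rw [outcome, dif_pos hex, ← (h _).1 hex.choose_spec.1, hex.choose_spec.2]

lemma ncard_contracts (h : Assigns X ν) (A : S → C → Prop) :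
    {x ∈ X | A x.student x.school}.ncard = {s | A s (ν s)}.ncard := by
  refine Set.ncard_congr (fun x _ => x.student) ?_ ?_ ?_
  · rintro x ⟨hx, hA⟩
    rw [← (h x).1 hx] at hA
    exact hA
  · rintro x y ⟨hx, -⟩ ⟨hy, -⟩ hxy
    exact h.feasibleForStudents x hx y hy hxy
  · intro s hs
    exact ⟨⟨s, _, ν s, rfl⟩, ⟨(h _).2 rfl, hs⟩, rfl⟩

lemma dist_eq (h : Assigns X ν) : Pb.dist X = count fun s => (ν s, Pb.type s) := by
  funext a
  rw [dist, h.ncard_contracts fun s c => c = a.1 ∧ Pb.type s = a.2, count]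
  simp only [Prod.ext_iff]

lemma feasible_iff (h : Assigns X ν) :
    Feasible Pb.cap X ↔ ∀ c, {s | ν s = c}.ncard ≤ Pb.cap c := by
  simp only [Feasible, h.feasibleForStudents, true_and]
  exact forall_congr' fun c => by rw [h.ncard_contracts fun _ c' => c' = c]

lemma mem_target_iff [Fintype S] [Fintype D] [Fintype C] [Fintype T] {p q : C → T → ℕ}
    (h : Assigns X ν) : (count fun s => (ν s, Pb.type s)) ∈ Pb.target p q ↔
      Pb.SatisfiesGoal (schoolLevelPolicy p q) X ∧ Feasible Pb.cap X := by
  rw [count_mem_target_iff, h.feasible_iff, SatisfiesGoal, h.dist_eq]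
  rfl

end Assigns

variable (Pb) in
lemma assigns_initial : Assigns Pb.initial Pb.initialSchool := by
  intro x
  obtain ⟨hx, hs⟩ := (Pb.initial_matched x.student).choose_spec.1
  constructor
  · intro h
    rw [initialSchool, Pb.initial_feasible.1 _ hx x h hs]
  · intro h
    rwa [← contract_ext hs h]

end Matchings

/-! ### The pointing graph -/

section Pointing

variable {Pb : Problem S D C T} {Ξ : Set (Distribution C T)} {master : StrictRanking S}
  {Q : S → StrictRanking (C × T)} {st : TTCState S C T}

/-- Student `s₁` points to a pair that points to student `s₂`. -/
def Leads (Pb : Problem S D C T) (Ξ : Set (Distribution C T)) (master : StrictRanking S)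
    (Q : S → StrictRanking (C × T)) (st : TTCState S C T) (s₁ s₂ : S) : Prop :=
  ∃ a, Pb.StudentPoints Ξ Q st s₁ a ∧ Pb.PairPoints Ξ master st a s₂

/-- The priority order of a pair as a ranking of the students. -/
def priorityRanking (Pb : Problem S D C T) (master : StrictRanking S) (a : C × T) :
    StrictRanking S where
  rel := Pb.Priority master a
  irrefl s := by
    rintro (h | h)
    · exact h.2 h.1
    · exact master.irrefl s h.2
  trans s₁ s₂ s₃ := by
    rintro (h | h) (h' | h')
    · exact absurd h'.1 h.2
    · exact Or.inl ⟨h.1, fun h₃ => h.2 (h'.1.2 h₃)⟩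
    · exact Or.inl ⟨h.1.2 h'.1, h'.2⟩
    · exact Or.inr ⟨h.1.trans h'.1, master.trans _ _ _ h.2 h'.2⟩
  total s₁ s₂ hne := by
    have := master.total s₁ s₂ hne
    unfold Priority
    tauto

lemma Priority.master_of_ne {a : C × T} {s s' : S} (h : Pb.Priority master a s s')
    (hs : Pb.initialPair s ≠ a) : master.rel s s' :=
  h.elim (fun h => absurd h.1 hs) fun h => h.2

lemma StudentPoints.unique {s : S} {a b : C × T} (ha : Pb.StudentPoints Ξ Q st s a)
    (hb : Pb.StudentPoints Ξ Q st s b) : a = b := by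
  by_contra hne
  exact (Q s).asymm (ha.2.2 b hb.2.1 (Ne.symm hne)) (hb.2.2 a ha.2.1 hne)

lemma PairPoints.unique {a : C × T} {s s' : S} (hs : Pb.PairPoints Ξ master st a s)
    (hs' : Pb.PairPoints Ξ master st a s') : s = s' := by
  by_contra hne
  exact (Pb.priorityRanking master a).asymm (hs.2.2 s' hs'.2.1 (Ne.symm hne))
    (hs'.2.2 s hs.2.1 hne)

lemma leads_unique (x y z : S) (hy : Pb.Leads Ξ master Q st x y)
    (hz : Pb.Leads Ξ master Q st x z) : y = z := by
  obtain ⟨a, ha, hay⟩ := hy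
  obtain ⟨b, hb, hbz⟩ := hz
  obtain rfl := ha.unique hb
  exact hay.unique hbz

lemma OnCycle.exists_points {s : S} (h : Pb.OnCycle Ξ master Q st s) :
    ∃ a, Pb.StudentPoints Ξ Q st s a := by
  obtain ⟨_, ⟨a, ha, -⟩, -⟩ := TransGen.head'_iff.1 h
  exact ⟨a, ha⟩

lemma OnCycle.assigned_eq {s : S} (h : Pb.OnCycle Ξ master Q st s) : st.assigned s = none :=
  h.exists_points.elim fun _ h => h.1

lemma OnCycle.of_reaches {s u : S} (h : Pb.OnCycle Ξ master Q st s)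
    (hsu : ReflTransGen (Pb.Leads Ξ master Q st) s u) : Pb.OnCycle Ξ master Q st u :=
  transGen_self_of_reflTransGen leads_unique h hsu

lemma currentPair_of_none {s : S} (h : st.assigned s = none) :
    Pb.currentPair st s = Pb.initialPair s := by simp [currentPair, h]

lemma currentPair_of_some {s : S} {a : C × T} (h : st.assigned s = some a) :
    Pb.currentPair st s = a := by simp [currentPair, h]

lemma currentDist_eq_count : Pb.currentDist st = count (Pb.currentPair st) := rfl

lemma Remaining.exists_pairPoints [Finite S] {a : C × T} (h : Pb.Remaining Ξ st a) :
    ∃ s, Pb.PairPoints Ξ master st a s := by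
  obtain ⟨s, hs, htop⟩ :=
    (Pb.priorityRanking master a).exists_top (A := {s | Pb.Candidate Ξ st s a}) h.2
  exact ⟨s, h, hs, htop⟩

lemma candidate_initialPair (hmem : Pb.currentDist st ∈ Ξ) {s : S} (h : st.assigned s = none) :
    Pb.Candidate Ξ st s (Pb.initialPair s) := ⟨h, exchangeMem_self hmem _⟩

/-- A pair that points to a student with another initial pair is the initial pair of no
unassigned student. -/
lemma PairPoints.initialPair_ne (hmem : Pb.currentDist st ∈ Ξ) {b : C × T} {u s : S}
    (h : Pb.PairPoints Ξ master st b u) (hu : Pb.initialPair u ≠ b)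
    (hs : st.assigned s = none) : Pb.initialPair s ≠ b := by
  rintro rfl
  have hne : s ≠ u := by
    rintro rfl
    exact hu rfl
  rcases h.2.2 s (candidate_initialPair hmem hs) hne with h' | h'
  · exact hu h'.1
  · exact hu (h'.1.2 rfl)

lemma ttcStep_assigned_of_points {s : S} {a : C × T} (h : Pb.OnCycle Ξ master Q st s)
    (ha : Pb.StudentPoints Ξ Q st s a) : (Pb.ttcStep Ξ master Q st).assigned s = some a := by
  have hex : Pb.OnCycle Ξ master Q st s ∧ ∃ a, Pb.StudentPoints Ξ Q st s a := ⟨h, a, ha⟩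
  simp only [ttcStep]
  rw [dif_pos hex, hex.2.choose_spec.unique ha]

lemma ttcStep_assigned_of_not {s : S} (h : ¬ Pb.OnCycle Ξ master Q st s) :
    (Pb.ttcStep Ξ master Q st).assigned s = st.assigned s := by
  simp only [ttcStep]
  rw [dif_neg fun h' => h h'.1]

lemma ttcStep_assigned_of_some {s : S} {a : C × T} (h : st.assigned s = some a) :
    (Pb.ttcStep Ξ master Q st).assigned s = some a := by
  rw [ttcStep_assigned_of_not fun h' => by simp [h'.assigned_eq] at h, h]

lemma assigned_of_ttcStep_none {s : S} (h : (Pb.ttcStep Ξ master Q st).assigned s = none) :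
    st.assigned s = none := by
  cases hs : st.assigned s with
  | none => rfl
  | some a => rw [ttcStep_assigned_of_some hs] at h; exact h

lemma not_onCycle_of_ttcStep_none {s : S}
    (h : (Pb.ttcStep Ξ master Q st).assigned s = none) : ¬ Pb.OnCycle Ξ master Q st s := by
  intro hc
  obtain ⟨a, ha⟩ := hc.exists_points
  simp [ttcStep_assigned_of_points hc ha] at h

lemma Remaining.of_ttcStep {a : C × T}
    (h : Pb.Remaining Ξ (Pb.ttcStep Ξ master Q st) a) : Pb.Remaining Ξ st a := by
  have h' := h.1
  simp only [ttcStep, Set.mem_union, not_or, Set.mem_ofPred_eq, not_not] at h'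
  exact h'

/-- A step trades along the cycles: up to a permutation `σ` of the students, only pairs that point
to a student with another initial pair change the assignment. -/
lemma exists_perm_ttcStep [Finite S] (Pb : Problem S D C T) (Ξ : Set (Distribution C T))
    (master : StrictRanking S) (Q : S → StrictRanking (C × T)) (st : TTCState S C T) :
    ∃ σ : Equiv.Perm S, ∀ s,
      Pb.currentPair (Pb.ttcStep Ξ master Q st) s ≠ Pb.currentPair st (σ s) →
        Pb.OnCycle Ξ master Q st (σ s) ∧
        Pb.PairPoints Ξ master st (Pb.currentPair (Pb.ttcStep Ξ master Q st) s) (σ s) ∧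
        Pb.currentPair st (σ s) = Pb.initialPair (σ s) := by
  obtain ⟨σ, hσ⟩ := exists_perm_cycles (R := Pb.Leads Ξ master Q st) leads_unique
  refine ⟨σ, fun s hne => ?_⟩
  by_cases hs : Pb.OnCycle Ξ master Q st s
  · have hlead := (hσ s).1 hs
    have hc : Pb.OnCycle Ξ master Q st (σ s) := hs.of_reaches (ReflTransGen.single hlead)
    obtain ⟨a, ha, hau⟩ := hlead
    rw [currentPair_of_some (ttcStep_assigned_of_points hs ha)]
    exact ⟨hc, hau, currentPair_of_none hc.assigned_eq⟩
  · refine absurd ?_ hne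
    rw [(hσ s).2 hs, currentPair, currentPair, ttcStep_assigned_of_not hs]

end Pointing

/-! ### Candidates under the policy -/

section Policy

variable [Fintype D] [Fintype C] [Fintype T] {Pb : Problem S D C T}
  {p q : C → T → ℕ} {master : StrictRanking S} {Q : S → StrictRanking (C × T)}
  {st : TTCState S C T}

/-- The invariant of a run that starts in the policy: the distribution satisfies the policy, and the
removed pairs have no candidates. -/
structure Sound (Pb : Problem S D C T) (p q : C → T → ℕ) (st : TTCState S C T) : Prop where
  mem : Pb.currentDist st ∈ Pb.target p q
  removed : ∀ b ∈ st.removed, ∀ s, ¬ Pb.Candidate (Pb.target p q) st s b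

lemma Sound.remaining (h : Pb.Sound p q st) {b : C × T} {s : S}
    (hs : Pb.Candidate (Pb.target p q) st s b) : Pb.Remaining (Pb.target p q) st b :=
  ⟨fun hb => h.removed b hb s hs, s, hs⟩

lemma Sound.exists_studentPoints (h : Pb.Sound p q st) {s : S} (hs : st.assigned s = none) :
    ∃ a, Pb.StudentPoints (Pb.target p q) Q st s a := by
  obtain ⟨a, ha, htop⟩ := (Q s).exists_top (A := {a | Pb.Remaining (Pb.target p q) st a})
    ⟨_, h.remaining (candidate_initialPair h.mem hs)⟩
  exact ⟨a, hs, ha, htop⟩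

lemma Candidate.bounds {s : S} {b : C × T} (h : Pb.Candidate (Pb.target p q) st s b)
    (hs : Pb.initialPair s ≠ b) :
    p (Pb.initialPair s).1 (Pb.initialPair s).2 < Pb.currentDist st (Pb.initialPair s) ∧
      Pb.currentDist st b < q b.1 b.2 ∧
      ((Pb.initialPair s).1 = b.1 ∨ ∑ t, Pb.currentDist st (b.1, t) < Pb.cap b.1) :=
  of_exchangeMem_target hs h.2

/-- Two pairs that point to students with other initial pairs point to the same student if each of
these students could move to the school of the other pair: both pairs rank the two students by the
master list. -/
lemma PairPoints.eq_of_cross (hmem : Pb.currentDist st ∈ Pb.target p q) {b₁ b₂ : C × T}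
    {u₁ u₂ : S} (h₁ : Pb.PairPoints (Pb.target p q) master st b₁ u₁)
    (hne₁ : Pb.initialPair u₁ ≠ b₁)
    (h₂ : Pb.PairPoints (Pb.target p q) master st b₂ u₂) (hne₂ : Pb.initialPair u₂ ≠ b₂)
    (h₁₂ : (Pb.initialPair u₁).1 = b₂.1 ∨ ∑ t, Pb.currentDist st (b₂.1, t) < Pb.cap b₂.1)
    (h₂₁ : (Pb.initialPair u₂).1 = b₁.1 ∨ ∑ t, Pb.currentDist st (b₁.1, t) < Pb.cap b₁.1) :
    u₁ = u₂ := by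
  obtain ⟨hp₁, hq₁, -⟩ := h₁.2.1.bounds hne₁
  obtain ⟨hp₂, hq₂, -⟩ := h₂.2.1.bounds hne₂
  have hc₁₂ : Pb.Candidate (Pb.target p q) st u₁ b₂ :=
    ⟨h₁.2.1.1, exchangeMem_target hmem (h₂.initialPair_ne hmem hne₂ h₁.2.1.1) hp₁ hq₂ h₁₂⟩
  have hc₂₁ : Pb.Candidate (Pb.target p q) st u₂ b₁ :=
    ⟨h₂.2.1.1, exchangeMem_target hmem (h₁.initialPair_ne hmem hne₁ h₂.2.1.1) hp₂ hq₁ h₂₁⟩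
  by_contra hne
  exact master.asymm ((h₁.2.2 u₂ hc₂₁ (Ne.symm hne)).master_of_ne hne₁)
    ((h₂.2.2 u₁ hc₁₂ hne).master_of_ne hne₂)

lemma PairPoints.eq_of_initialPair_eq (hmem : Pb.currentDist st ∈ Pb.target p q)
    {b₁ b₂ : C × T} {u₁ u₂ : S} (h₁ : Pb.PairPoints (Pb.target p q) master st b₁ u₁)
    (hne₁ : Pb.initialPair u₁ ≠ b₁)
    (h₂ : Pb.PairPoints (Pb.target p q) master st b₂ u₂) (hne₂ : Pb.initialPair u₂ ≠ b₂)
    (h : Pb.initialPair u₁ = Pb.initialPair u₂) : u₁ = u₂ := by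
  refine h₁.eq_of_cross hmem hne₁ h₂ hne₂ ?_ ?_
  · exact h ▸ (h₂.2.1.bounds hne₂).2.2
  · exact h ▸ (h₁.2.1.bounds hne₁).2.2

/-! ### Pairs without candidates -/

variable [Fintype S]

/-- If no unassigned student is permissible to the pair `b`, then no assignment in the policy
that keeps the assignments already made gives `b` to an unassigned student: otherwise an exchange
towards that assignment would make some unassigned student permissible to `b`. -/
lemma ne_of_no_candidate (hmem : Pb.currentDist st ∈ Pb.target p q) {b : C × T}
    (hb : ∀ s, ¬ Pb.Candidate (Pb.target p q) st s b) {μ : S → C × T}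
    (hμ : ∀ s, st.assigned s ≠ none → μ s = Pb.currentPair st s)
    (hcount : count μ ∈ Pb.target p q) {s : S} (hs : st.assigned s = none) : μ s ≠ b := by
  intro hsb
  have hown : ∀ u, Pb.currentPair st u = b → μ u = b := by
    intro u hu
    by_cases hn : st.assigned u = none
    · rw [currentPair_of_none hn] at hu
      exact absurd (hu ▸ candidate_initialPair hmem hn) (hb u)
    · rw [hμ u hn, hu]
  have hlt : Pb.currentDist st b < count μ b := by
    refine Set.ncard_lt_ncard ⟨hown, fun h => ?_⟩ (Set.toFinite _)
    have hsb' : Pb.currentPair st s = b := h hsb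
    rw [currentPair_of_none hs] at hsb'
    exact hb s (hsb' ▸ candidate_initialPair hmem hs)
  obtain ⟨a, ha, -, hex⟩ := mConvex_target _ hcount _ hmem b hlt
  obtain ⟨u, hu, hu'⟩ := exists_of_ncard_lt ha
  have hn : st.assigned u = none := by
    by_contra hn
    exact hu' ((hμ u hn).trans hu)
  rw [currentPair_of_none hn] at hu
  subst hu
  exact hb u ⟨hn, hex⟩

lemma Sound.exists_onCycle (h : Pb.Sound p q st) {s : S} (hs : st.assigned s = none) :
    ∃ u, Pb.OnCycle (Pb.target p q) master Q st u := by
  refine exists_transGen_self (U := {u | st.assigned u = none}) ⟨s, hs⟩ fun u hu => ?_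
  obtain ⟨a, ha⟩ := h.exists_studentPoints (Q := Q) hu
  obtain ⟨v, hv⟩ := ha.2.1.exists_pairPoints (master := master)
  exact ⟨v, hv.2.1.1, a, ha, hv⟩

/-! ### A step preserves the policy -/

lemma ttcStep_mem (hmem : Pb.currentDist st ∈ Pb.target p q) :
    Pb.currentDist (Pb.ttcStep (Pb.target p q) master Q st) ∈ Pb.target p q := by
  obtain ⟨σ, hσ⟩ := Pb.exists_perm_ttcStep (Pb.target p q) master Q st
  set st' := Pb.ttcStep (Pb.target p q) master Q st
  have hpoints : ∀ s, Pb.currentPair st' s ≠ Pb.currentPair st (σ s) →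
      Pb.PairPoints (Pb.target p q) master st (Pb.currentPair st' s) (σ s) ∧
      Pb.currentPair st (σ s) = Pb.initialPair (σ s) ∧
      Pb.initialPair (σ s) ≠ Pb.currentPair st' s := fun s hs =>
    ⟨(hσ s hs).2.1, (hσ s hs).2.2, fun h => hs ((hσ s hs).2.2.trans h).symm⟩
  have hmem' := count_mem_target_iff.1 hmem
  refine count_mem_target_iff.2 ⟨fun c t => ⟨?_, ?_⟩, fun c => ?_⟩
  · -- At most one student leaves the pair `(c, t)` for another pair.
    have hle := ncard_le_succ (A := fun s => Pb.currentPair st (σ s) = (c, t))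
      (B := fun s => Pb.currentPair st' s = (c, t)) (by
        intro s s' hs hs' hu hu'
        obtain ⟨h₁, h₁', h₁''⟩ := hpoints s fun h => hs' (h.trans hs)
        obtain ⟨h₂, h₂', h₂''⟩ := hpoints s' fun h => hu' (h.trans hu)
        refine σ.injective (h₁.eq_of_initialPair_eq hmem h₁'' h₂ h₂'' ?_)
        rw [← h₁', ← h₂', hs, hu])
    rw [ncard_perm σ fun s => Pb.currentPair st s = (c, t)] at hle
    by_contra! hlt
    have hlow := (hmem'.1 c t).1
    have hlt' : count (Pb.currentPair st') (c, t) < count (Pb.currentPair st) (c, t) :=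
      hlt.trans_le hlow
    rw [count, count, ← ncard_perm σ fun s => Pb.currentPair st s = (c, t)] at hlt'
    obtain ⟨s, hs, hs'⟩ := exists_of_ncard_lt hlt'
    obtain ⟨h₁, h₁', h₁''⟩ := hpoints s fun h => hs' (h.trans hs)
    have hp := (h₁.2.1.bounds h₁'').1
    rw [← h₁', hs] at hp
    change _ < {s | Pb.currentPair st s = (c, t)}.ncard at hp
    change {s | Pb.currentPair st' s = (c, t)}.ncard < _ at hlt
    simp only at hp
    omega
  · -- At most one student enters the pair `(c, t)` from another pair.
    have hle := ncard_le_succ (A := fun s => Pb.currentPair st' s = (c, t))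
      (B := fun s => Pb.currentPair st (σ s) = (c, t)) (by
        intro s s' hs hs' hu hu'
        obtain ⟨h₁, -, -⟩ := hpoints s fun h => hs' (h.symm.trans hs)
        obtain ⟨h₂, -, -⟩ := hpoints s' fun h => hu' (h.symm.trans hu)
        rw [hs] at h₁
        rw [hu] at h₂
        exact σ.injective (h₁.unique h₂))
    rw [ncard_perm σ fun s => Pb.currentPair st s = (c, t)] at hle
    by_contra! hlt
    have hup := (hmem'.1 c t).2
    have hlt' : count (Pb.currentPair st) (c, t) < count (Pb.currentPair st') (c, t) :=
      hup.trans_lt hlt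
    rw [count, count, ← ncard_perm σ fun s => Pb.currentPair st s = (c, t)] at hlt'
    obtain ⟨s, hs, hs'⟩ := exists_of_ncard_lt hlt'
    obtain ⟨h₁, h₁', h₁''⟩ := hpoints s fun h => hs' (h.symm.trans hs)
    have hq := (h₁.2.1.bounds h₁'').2.1
    rw [hs] at hq
    change {s | Pb.currentPair st s = (c, t)}.ncard < _ at hq
    change _ < {s | Pb.currentPair st' s = (c, t)}.ncard at hlt
    simp only at hq
    omega
  · by_cases hfull : {s | (Pb.currentPair st s).1 = c}.ncard < Pb.cap c
    · -- The pairs at `c` that point to students from elsewhere all point to the same student.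
      refine (ncard_le_succ (B := fun s => (Pb.currentPair st (σ s)).1 = c) ?_).trans ?_
      · intro s s' hs hs' hu hu'
        obtain ⟨h₁, -, h₁''⟩ := hpoints s fun h => hs' (h ▸ hs)
        obtain ⟨h₂, -, h₂''⟩ := hpoints s' fun h => hu' (h ▸ hu)
        rw [← sum_school_count] at hfull
        exact σ.injective (h₁.eq_of_cross hmem h₁'' h₂ h₂'' (Or.inr (hu ▸ hfull))
          (Or.inr (hs ▸ hfull)))
      · rw [ncard_perm σ fun s => (Pb.currentPair st s).1 = c]
        exact hfull
    · -- The pairs at the full school `c` point to students initially at `c`.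
      refine (ncard_le_of_imp (B := fun s => (Pb.currentPair st (σ s)).1 = c) ?_).trans ?_
      · intro s hs
        by_contra hs'
        obtain ⟨h₁, h₁', h₁''⟩ := hpoints s fun h => hs' (h ▸ hs)
        rcases (h₁.2.1.bounds h₁'').2.2 with h | h
        · rw [h₁', h] at hs'
          exact hs' hs
        · rw [currentDist_eq_count, sum_school_count, hs] at h
          exact hfull h
      · rw [ncard_perm σ fun s => (Pb.currentPair st s).1 = c]
        exact hmem'.2 c

lemma Sound.ttcStep (h : Pb.Sound p q st) :
    Pb.Sound p q (Pb.ttcStep (Pb.target p q) master Q st) := by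
  classical
  refine ⟨ttcStep_mem h.mem, fun b hb s hs => ?_⟩
  have hno : ∀ s, ¬ Pb.Candidate (Pb.target p q) st s b := by
    rcases hb with hb | hb
    · exact h.removed b hb
    · exact fun s hs => hb ⟨s, hs⟩
  have hn := assigned_of_ttcStep_none hs.1
  obtain ⟨η, hη, heq⟩ := hs.2
  rw [currentDist_eq_count, ← currentPair_of_none hs.1, ← count_update _ s b] at heq
  refine ne_of_no_candidate h.mem hno (fun u hu => ?_) (add_right_cancel heq ▸ hη) hn
    (by simp)
  have hne : u ≠ s := by
    rintro rfl
    exact hu hn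
  obtain ⟨a, ha⟩ := Option.ne_none_iff_exists'.1 hu
  rw [Function.update_of_ne hne, currentPair_of_some (ttcStep_assigned_of_some ha),
    currentPair_of_some ha]

/-! ### Pointing is persistent -/

/-- A pair keeps pointing to the same student until that student is assigned. -/
lemma PairPoints.ttcStep (h : Pb.Sound p q st) {b : C × T} {u : S}
    (hb : Pb.PairPoints (Pb.target p q) master st b u)
    (hu : ¬ Pb.OnCycle (Pb.target p q) master Q st u) :
    Pb.PairPoints (Pb.target p q) master (Pb.ttcStep (Pb.target p q) master Q st) b u := by
  have hmem := h.mem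
  have h' : Pb.Sound p q (Pb.ttcStep (Pb.target p q) master Q st) := h.ttcStep
  have hn : (Pb.ttcStep (Pb.target p q) master Q st).assigned u = none := by
    rw [ttcStep_assigned_of_not hu, hb.2.1.1]
  -- It suffices that `u` stays permissible and that no other student becomes permissible.
  suffices H : Pb.Candidate (Pb.target p q) (Pb.ttcStep (Pb.target p q) master Q st) u b ∧
      ∀ s, Pb.Candidate (Pb.target p q) (Pb.ttcStep (Pb.target p q) master Q st) s b → s ≠ u →
        Pb.Priority master b u s from ⟨h'.remaining H.1, H.1, H.2⟩
  by_cases hne : Pb.initialPair u = b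
  · refine ⟨hne ▸ candidate_initialPair h'.mem hn, fun s hs hsu => ?_⟩
    by_cases hsb : Pb.initialPair s = b
    · exact hb.2.2 s (hsb ▸ candidate_initialPair hmem (assigned_of_ttcStep_none hs.1)) hsu
    · exact Or.inl ⟨hne, hsb⟩
  obtain ⟨σ, hσ⟩ := Pb.exists_perm_ttcStep (Pb.target p q) master Q st
  obtain ⟨hp, hq, hcap⟩ := hb.2.1.bounds hne
  set st' := Pb.ttcStep (Pb.target p q) master Q st
  -- A pair that trades with a student who is not its owner cannot meet the conditions of
  -- `eq_of_cross` with `b`: that student would be `u`, who is not on a cycle.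
  have hpoints : ∀ s, Pb.currentPair st' s ≠ Pb.currentPair st (σ s) →
      Pb.PairPoints (Pb.target p q) master st (Pb.currentPair st' s) (σ s) ∧
      Pb.currentPair st (σ s) = Pb.initialPair (σ s) ∧
      Pb.initialPair (σ s) ≠ Pb.currentPair st' s ∧ σ s ≠ u := fun s hs =>
    ⟨(hσ s hs).2.1, (hσ s hs).2.2, fun h => hs ((hσ s hs).2.2.trans h).symm,
      fun h => hu (h ▸ (hσ s hs).1)⟩
  have hb' : Pb.currentDist st' b ≤ Pb.currentDist st b := by
    rw [currentDist, currentDist, ← ncard_perm σ fun s => Pb.currentPair st s = b]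
    refine ncard_le_of_imp fun s hs => ?_
    by_contra hs'
    obtain ⟨h₁, -, -, h₁'⟩ := hpoints s fun h => hs' (h.symm.trans hs)
    rw [hs] at h₁
    exact h₁' (h₁.unique hb)
  have ha' : Pb.currentDist st (Pb.initialPair u) ≤ Pb.currentDist st' (Pb.initialPair u) := by
    rw [currentDist, currentDist,
      ← ncard_perm σ fun s => Pb.currentPair st s = Pb.initialPair u]
    refine ncard_le_of_imp fun s hs => ?_
    by_contra hs'
    obtain ⟨h₁, h₁', h₁'', h₁u⟩ := hpoints s fun h => hs' (h.trans hs)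
    exact h₁u (h₁.eq_of_initialPair_eq hmem h₁'' hb hne (h₁'.symm.trans hs))
  refine ⟨⟨hn, exchangeMem_target h'.mem hne (hp.trans_le ha') (hb'.trans_lt hq) ?_⟩, ?_⟩
  · refine hcap.imp id fun hcap => lt_of_le_of_lt ?_ hcap
    rw [currentDist_eq_count, currentDist_eq_count, sum_school_count, sum_school_count,
      ← ncard_perm σ fun s => (Pb.currentPair st s).1 = b.1]
    refine ncard_le_of_imp fun s hs => ?_
    by_contra hs'
    obtain ⟨h₁, -, h₁'', h₁u⟩ := hpoints s fun h => hs' (h ▸ hs)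
    exact h₁u (h₁.eq_of_cross hmem h₁'' hb hne (Or.inr hcap) (Or.inr (hs ▸ hcap)))
  · intro s hs hsu
    have hsn := assigned_of_ttcStep_none hs.1
    have hsb : Pb.initialPair s ≠ b := hb.initialPair_ne hmem hne hsn
    obtain ⟨hps, -, hcaps⟩ := hs.bounds hsb
    refine hb.2.2 s ⟨hsn, exchangeMem_target hmem hsb (hps.trans_le ?_) hq ?_⟩ hsu
    · rw [currentDist, currentDist,
        ← ncard_perm σ fun v => Pb.currentPair st v = Pb.initialPair s]
      refine ncard_le_of_imp fun v hv => ?_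
      by_contra hv'
      -- A pair that still has unassigned owners points to one of them, and so gains no student.
      obtain ⟨h₁, -, h₁'', -⟩ := hpoints v fun h => hv' (h.symm.trans hv)
      exact h₁.initialPair_ne hmem h₁'' hsn hv.symm
    · by_contra! hfull
      have hlt := (hcaps.resolve_left hfull.1).trans_le hfull.2
      rw [currentDist_eq_count, currentDist_eq_count, sum_school_count, sum_school_count,
        ← ncard_perm σ fun v => (Pb.currentPair st v).1 = b.1] at hlt
      obtain ⟨v, hv, hv'⟩ := exists_of_ncard_lt hlt
      -- The full school of `b` loses a student to another school, which therefore has room.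
      obtain ⟨h₁, h₁', h₁'', h₁u⟩ := hpoints v fun h => hv' (h ▸ hv)
      rw [h₁'] at hv
      refine h₁u (h₁.eq_of_cross hmem h₁'' hb hne (Or.inl hv) (Or.inr ?_))
      exact (h₁.2.1.bounds h₁'').2.2.resolve_left fun h => hv' (h.symm.trans hv)

/-- If `s` is not on a cycle, a chain of pointing from a pair to `s` is still there after the
step. -/
lemma chain_ttcStep (h : Pb.Sound p q st) {b : C × T} {u s : S}
    (hs : ¬ Pb.OnCycle (Pb.target p q) master Q st s)
    (hb : Pb.PairPoints (Pb.target p q) master st b u)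
    (hus : ReflTransGen (Pb.Leads (Pb.target p q) master Q st) u s) :
    Pb.PairPoints (Pb.target p q) master (Pb.ttcStep (Pb.target p q) master Q st) b u ∧
      ReflTransGen (Pb.Leads (Pb.target p q) master Q
        (Pb.ttcStep (Pb.target p q) master Q st)) u s := by
  refine ⟨hb.ttcStep h fun hu => hs (hu.of_reaches hus), ?_⟩
  clear hb
  induction hus using ReflTransGen.head_induction_on with
  | refl => exact ReflTransGen.refl
  | @head x y hxy hys ih =>
    refine ReflTransGen.head ?_ ih
    have hx : ¬ Pb.OnCycle (Pb.target p q) master Q st x := fun hx =>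
      hs (hx.of_reaches (ReflTransGen.head hxy hys))
    obtain ⟨a, ha, hay⟩ := hxy
    have hay' := hay.ttcStep h fun hy => hs (OnCycle.of_reaches hy hys)
    exact ⟨a, ⟨by rw [ttcStep_assigned_of_not hx, ha.1], hay'.1,
      fun b hb => ha.2.2 b hb.of_ttcStep⟩, hay'⟩

end Policy

/-! ### The run of the algorithm -/

section Run

variable {Pb : Problem S D C T} {Ξ : Set (Distribution C T)} {master : StrictRanking S}
  {Q : S → StrictRanking (C × T)}

lemma ttcRun_succ (n : ℕ) : Pb.ttcRun Ξ master Q (n + 1) =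
    Pb.ttcStep Ξ master Q (Pb.ttcRun Ξ master Q n) := Function.iterate_succ_apply' _ _ _

lemma ttcRun_assigned_mono {m n : ℕ} (hmn : m ≤ n) {s : S} {a : C × T}
    (h : (Pb.ttcRun Ξ master Q m).assigned s = some a) :
    (Pb.ttcRun Ξ master Q n).assigned s = some a := by
  induction n, hmn using Nat.le_induction with
  | base => exact h
  | succ n _ ih =>
    rw [ttcRun_succ]
    exact ttcStep_assigned_of_some ih

lemma ttcRun_remaining_antitone {m n : ℕ} (hmn : m ≤ n) {a : C × T}
    (h : Pb.Remaining Ξ (Pb.ttcRun Ξ master Q n) a) :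
    Pb.Remaining Ξ (Pb.ttcRun Ξ master Q m) a := by
  induction n, hmn using Nat.le_induction with
  | base => exact h
  | succ n _ ih =>
    rw [ttcRun_succ] at h
    exact ih h.of_ttcStep

/-- Student `s` trades at step `m` and is assigned the pair `a`. -/
def TradesAt (Pb : Problem S D C T) (Ξ : Set (Distribution C T)) (master : StrictRanking S)
    (Q : S → StrictRanking (C × T)) (m : ℕ) (s : S) (a : C × T) : Prop :=
  Pb.OnCycle Ξ master Q (Pb.ttcRun Ξ master Q m) s ∧
    Pb.StudentPoints Ξ Q (Pb.ttcRun Ξ master Q m) s a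

lemma TradesAt.assigned {m n : ℕ} {s : S} {a : C × T} (h : Pb.TradesAt Ξ master Q m s a)
    (hmn : m < n) : (Pb.ttcRun Ξ master Q n).assigned s = some a := by
  refine ttcRun_assigned_mono (Nat.succ_le_of_lt hmn) ?_
  rw [ttcRun_succ]
  exact ttcStep_assigned_of_points h.1 h.2

lemma exists_tradesAt {n : ℕ} {s : S} {a : C × T}
    (h : (Pb.ttcRun Ξ master Q n).assigned s = some a) :
    ∃ m < n, Pb.TradesAt Ξ master Q m s a := by
  induction n with
  | zero => simp [ttcRun] at h
  | succ n ih =>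
    by_cases hs : Pb.OnCycle Ξ master Q (Pb.ttcRun Ξ master Q n) s
    · obtain ⟨b, hb⟩ := hs.exists_points
      rw [ttcRun_succ, ttcStep_assigned_of_points hs hb] at h
      obtain rfl : b = a := Option.some.inj h
      exact ⟨n, n.lt_succ_self, hs, hb⟩
    · rw [ttcRun_succ, ttcStep_assigned_of_not hs] at h
      obtain ⟨m, hm, h'⟩ := ih h
      exact ⟨m, hm.trans n.lt_succ_self, h'⟩

lemma TradesAt.not_onCycle_of_lt {m n : ℕ} {s : S} {a : C × T}
    (h : Pb.TradesAt Ξ master Q m s a) (hn : n < m) :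
    ¬ Pb.OnCycle Ξ master Q (Pb.ttcRun Ξ master Q n) s := by
  intro hc
  obtain ⟨b, hb⟩ := hc.exists_points
  have h' := TradesAt.assigned (Q := Q) ⟨hc, hb⟩ hn
  rw [h.2.1] at h'
  cases h'

/-- As long as student `s` does not trade, the run does not depend on her ranking. -/
lemma ttcStep_congr {Q' : S → StrictRanking (C × T)} {st : TTCState S C T} {s : S}
    (hQ : ∀ u, u ≠ s → Q u = Q' u) (hs : ¬ Pb.OnCycle Ξ master Q st s)
    (hs' : ¬ Pb.OnCycle Ξ master Q' st s) :
    Pb.ttcStep Ξ master Q st = Pb.ttcStep Ξ master Q' st := by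
  have key : ∀ Q₁ Q₂ : S → StrictRanking (C × T), (∀ u, u ≠ s → Q₁ u = Q₂ u) →
      ¬ Pb.OnCycle Ξ master Q₁ st s → ∀ u, Pb.OnCycle Ξ master Q₁ st u →
        Pb.OnCycle Ξ master Q₂ st u := by
    intro Q₁ Q₂ h₁₂ h₁ u hu
    refine transGen_of_avoid (s := s) (fun x y hx => ?_) (fun z hz => ?_) hu
    · rintro ⟨a, ha, hay⟩
      refine ⟨a, ?_, hay⟩
      rwa [StudentPoints, ← h₁₂ x hx]
    · rintro rfl
      exact h₁ (hu.of_reaches hz)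
  have hassigned : (Pb.ttcStep Ξ master Q st).assigned = (Pb.ttcStep Ξ master Q' st).assigned := by
    funext u
    by_cases hu : Pb.OnCycle Ξ master Q st u
    · have hu' := key Q Q' hQ hs u hu
      have hne : u ≠ s := by
        rintro rfl
        exact hs hu
      obtain ⟨a, ha⟩ := hu.exists_points
      have ha' : Pb.StudentPoints Ξ Q' st u a := by rwa [StudentPoints, ← hQ u hne]
      rw [ttcStep_assigned_of_points hu ha, ttcStep_assigned_of_points hu' ha']
    · have hu' : ¬ Pb.OnCycle Ξ master Q' st u := fun h =>
        hu (key Q' Q (fun v hv => (hQ v hv).symm) hs' u h)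
      rw [ttcStep_assigned_of_not hu, ttcStep_assigned_of_not hu']
  calc Pb.ttcStep Ξ master Q st
      = ⟨(Pb.ttcStep Ξ master Q st).assigned, st.removed ∪ {a | ¬ ∃ s, Pb.Candidate Ξ st s a}⟩ :=
        rfl
    _ = Pb.ttcStep Ξ master Q' st := by rw [hassigned]; rfl

lemma ttcRun_congr {Q' : S → StrictRanking (C × T)} {s : S} (hQ : ∀ u, u ≠ s → Q u = Q' u)
    (n : ℕ) (hs : ∀ m < n, ¬ Pb.OnCycle Ξ master Q (Pb.ttcRun Ξ master Q m) s)
    (hs' : ∀ m < n, ¬ Pb.OnCycle Ξ master Q' (Pb.ttcRun Ξ master Q' m) s) :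
    Pb.ttcRun Ξ master Q n = Pb.ttcRun Ξ master Q' n := by
  induction n with
  | zero => rfl
  | succ n ih =>
    have hn := ih (fun m hm => hs m (hm.trans n.lt_succ_self))
      fun m hm => hs' m (hm.trans n.lt_succ_self)
    rw [ttcRun_succ, ttcRun_succ, ← hn]
    exact ttcStep_congr hQ (hs n n.lt_succ_self) (hn ▸ hs' n n.lt_succ_self)

lemma weak_iff {s : S} {P : Preference C} {R : StrictRanking (C × T)}
    (hR : Pb.IsHypothetical s P R) (c c' : C) :
    R.weak (c, Pb.type s) (c', Pb.type s) ↔ P.weak (some c) (some c') := by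
  rw [StrictRanking.weak, StrictRanking.weak, ← hR.1]
  simp

variable [Fintype D] [Fintype C] [Fintype T] {p q : C → T → ℕ}

/-- Against a ranking derived from `P`, a student only points to pairs of her own type that are at
least as good as her initial pair. -/
lemma StudentPoints.type_eq_and_weak {st : TTCState S C T} (h : Pb.Sound p q st) {s : S}
    {P : Preference C} (hQ : Pb.IsHypothetical s P (Q s)) {a : C × T}
    (ha : Pb.StudentPoints (Pb.target p q) Q st s a) :
    a.2 = Pb.type s ∧ (Q s).weak a (Pb.initialPair s) := by
  have hinit := h.remaining (candidate_initialPair h.mem ha.1)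
  have hweak : (Q s).weak a (Pb.initialPair s) := by
    by_cases hne : Pb.initialPair s = a
    · exact Or.inr hne.symm
    · exact Or.inl (ha.2.2 _ hinit hne)
  refine ⟨?_, hweak⟩
  by_contra hty
  have h' := hQ.2 a.1 a.2 hty
  rcases hweak with hw | hw
  · exact (Q s).asymm hw h'
  · rw [Prod.mk.eta, hw] at h'
    exact (Q s).irrefl _ h'

variable [Fintype S]

lemma sound_ttcRun (h₀ : Pb.SatisfiesGoal (schoolLevelPolicy p q) Pb.initial) (n : ℕ) :
    Pb.Sound p q (Pb.ttcRun (Pb.target p q) master Q n) := by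
  induction n with
  | zero =>
    refine ⟨?_, fun b hb => absurd hb (Set.notMem_empty b)⟩
    exact Pb.assigns_initial.mem_target_iff.2 ⟨h₀, Pb.initial_feasible⟩
  | succ n ih =>
    rw [ttcRun_succ]
    exact ih.ttcStep

lemma exists_all_assigned (h₀ : Pb.SatisfiesGoal (schoolLevelPolicy p q) Pb.initial)
    (master : StrictRanking S) (Q : S → StrictRanking (C × T)) :
    ∃ n, ∀ s, ∃ a, (Pb.ttcRun (Pb.target p q) master Q n).assigned s = some a := by
  suffices H : ∀ k n, {s | (Pb.ttcRun (Pb.target p q) master Q n).assigned s = none}.ncard ≤ k →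
      ∃ n, ∀ s, ∃ a, (Pb.ttcRun (Pb.target p q) master Q n).assigned s = some a from
    H _ 0 le_rfl
  intro k
  induction k with
  | zero =>
    intro n hn
    refine ⟨n, fun s => Option.ne_none_iff_exists'.1 fun hs => ?_⟩
    have := (Set.ncard_eq_zero (Set.toFinite _)).1 (Nat.le_zero.1 hn)
    exact Set.eq_empty_iff_forall_notMem.1 this s hs
  | succ k ih =>
    intro n hn
    by_cases hall : ∀ s, ∃ a, (Pb.ttcRun (Pb.target p q) master Q n).assigned s = some a
    · exact ⟨n, hall⟩
    · push Not at hall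
      obtain ⟨s, hs⟩ := hall
      have hs' : (Pb.ttcRun (Pb.target p q) master Q n).assigned s = none :=
        Option.eq_none_iff_forall_ne_some.2 hs
      obtain ⟨u, hu⟩ := (sound_ttcRun h₀ n).exists_onCycle (master := master) (Q := Q) hs'
      refine ih (n + 1) (Nat.lt_succ_iff.1 (lt_of_lt_of_le ?_ hn))
      rw [ttcRun_succ]
      refine Set.ncard_lt_ncard ⟨fun v hv => assigned_of_ttcStep_none hv, fun h => ?_⟩
        (Set.toFinite _)
      exact not_onCycle_of_ttcStep_none (h hu.assigned_eq) hu

/-! ### Properties of the outcome -/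

/-- The outcome of the algorithm: a school for each student, at which she arrives by a trade. -/
lemma exists_ttc_assigns (h₀ : Pb.SatisfiesGoal (schoolLevelPolicy p q) Pb.initial)
    (master : StrictRanking S) {P : S → Preference C}
    (hQ : ∀ s, Pb.IsHypothetical s (P s) (Q s)) :
    ∃ ν : S → C, Assigns (Pb.ttcMatching (Pb.target p q) master Q) ν ∧
      (count fun s => (ν s, Pb.type s)) ∈ Pb.target p q ∧
      ∀ s, ∃ m, Pb.TradesAt (Pb.target p q) master Q m s (ν s, Pb.type s) := by
  obtain ⟨n, hn⟩ := exists_all_assigned h₀ master Q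
  choose μ hμ using hn
  have htrade : ∀ s, ∃ m, Pb.TradesAt (Pb.target p q) master Q m s (μ s) := fun s =>
    (exists_tradesAt (hμ s)).imp fun _ h => h.2
  have hμν : ∀ s, μ s = ((μ s).1, Pb.type s) := by
    intro s
    obtain ⟨m, hm⟩ := htrade s
    exact Prod.ext rfl (hm.2.type_eq_and_weak (sound_ttcRun h₀ m) (hQ s)).1
  refine ⟨fun s => (μ s).1, fun x => ⟨?_, fun hx => ⟨n, (μ x.student).2, ?_⟩⟩, ?_,
    fun s => hμν s ▸ htrade s⟩
  · rintro ⟨m, t, hm⟩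
    have h₁ := ttcRun_assigned_mono (le_max_left m n) hm
    rw [ttcRun_assigned_mono (le_max_right m n) (hμ x.student)] at h₁
    exact congrArg Prod.fst (Option.some.inj h₁)
  · rw [hμ, ← hx]
  · have hcur : Pb.currentPair (Pb.ttcRun (Pb.target p q) master Q n) =
        fun s => ((μ s).1, Pb.type s) :=
      funext fun s => (currentPair_of_some (hμ s)).trans (hμν s)
    have h := (sound_ttcRun h₀ n (p := p) (q := q) (master := master) (Q := Q)).mem
    rwa [currentDist_eq_count, hcur] at h

lemma ttc_individuallyRational (h₀ : Pb.SatisfiesGoal (schoolLevelPolicy p q) Pb.initial)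
    (master : StrictRanking S) {P : S → Preference C}
    (hQ : ∀ s, Pb.IsHypothetical s (P s) (Q s)) :
    Pb.IndividuallyRational P (Pb.ttcMatching (Pb.target p q) master Q) := by
  intro s
  obtain ⟨ν, hν, -, htrade⟩ := exists_ttc_assigns h₀ master hQ
  obtain ⟨m, hm⟩ := htrade s
  rw [hν.outcome_eq, Pb.assigns_initial.outcome_eq, ← weak_iff (hQ s)]
  exact (hm.2.type_eq_and_weak (sound_ttcRun h₀ m) (hQ s)).2

/-- Among the students whose school differs in a dominating matching, one that trades first finds
a better pair without candidates, although the dominating matching gives her that pair and keeps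
all earlier assignments. -/
lemma ttc_not_paretoDominated (h₀ : Pb.SatisfiesGoal (schoolLevelPolicy p q) Pb.initial)
    (master : StrictRanking S) {P : S → Preference C}
    (hQ : ∀ s, Pb.IsHypothetical s (P s) (Q s)) {Y : Matching S Pb.homeC}
    (hY : Feasible Pb.cap Y) (hYgoal : Pb.SatisfiesGoal (schoolLevelPolicy p q) Y) :
    ¬ Pb.ParetoDominates P Y (Pb.ttcMatching (Pb.target p q) master Q) := by
  rintro ⟨hweak, s₀, hs₀⟩
  obtain ⟨ν, hν, -, htrade⟩ := exists_ttc_assigns h₀ master hQ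
  choose step hstep using htrade
  obtain ⟨ν', hν'⟩ : ∃ ν' : S → C, Assigns Y ν' := by
    refine exists_assigns hY.1 fun s => ?_
    by_contra hno
    have h := hweak s
    rw [hν.outcome_eq, outcome, dif_neg hno] at h
    rcases h with h | h
    · exact (P s).asymm h ((P s).outside_worst _)
    · cases h
  obtain ⟨s, hs, hmin⟩ := Set.exists_min_image {s | ν' s ≠ ν s} step (Set.toFinite _) ⟨s₀, by
    intro h
    rw [hν.outcome_eq, hν'.outcome_eq, h] at hs₀
    exact (P s₀).irrefl _ hs₀⟩
  have hrel : (Q s).rel (ν' s, Pb.type s) (ν s, Pb.type s) := by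
    have h := hweak s
    rw [hν.outcome_eq, hν'.outcome_eq, ← weak_iff (hQ s)] at h
    exact h.resolve_right fun h => hs (congrArg Prod.fst h)
  have hsound := sound_ttcRun h₀ (step s) (p := p) (q := q) (master := master) (Q := Q)
  have hno : ∀ u, ¬ Pb.Candidate (Pb.target p q)
      (Pb.ttcRun (Pb.target p q) master Q (step s)) u (ν' s, Pb.type s) := fun u hu =>
    (Q s).asymm hrel ((hstep s).2.2.2 _ (hsound.remaining hu) fun h => hs (congrArg Prod.fst h))
  refine ne_of_no_candidate hsound.mem hno (μ := fun u => (ν' u, Pb.type u)) (fun u hu => ?_)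
    (hν'.mem_target_iff.2 ⟨hYgoal, hY⟩) (hstep s).2.1 rfl
  have hlt : step u < step s := by
    by_contra! hle
    obtain ⟨a, ha⟩ := Option.ne_none_iff_exists'.1 hu
    have h := ttcRun_assigned_mono hle ha
    rw [(hstep u).2.1] at h
    cases h
  have heq : ν' u = ν u := by
    by_contra hne
    exact absurd (hmin u hne) (not_le.2 hlt)
  rw [currentPair_of_some ((hstep u).assigned hlt)]
  simp only [heq]

/-- A pair that student `s` can obtain by a report is among the remaining pairs when she trades
under another report. If she trades later under the latter, the chain of pointing from the pair to
`s` that closes the cycle under the former waits for her. -/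
lemma remaining_of_tradesAt (h₀ : Pb.SatisfiesGoal (schoolLevelPolicy p q) Pb.initial)
    {Q' : S → StrictRanking (C × T)} {s : S} (hQ : ∀ u, u ≠ s → Q u = Q' u) {m m' : ℕ}
    {a a' : C × T} (h : Pb.TradesAt (Pb.target p q) master Q m s a)
    (h' : Pb.TradesAt (Pb.target p q) master Q' m' s a') :
    Pb.Remaining (Pb.target p q) (Pb.ttcRun (Pb.target p q) master Q m) a' := by
  rcases le_or_gt m m' with hle | hlt
  · rw [ttcRun_congr hQ m (fun n hn => h.not_onCycle_of_lt hn)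
      fun n hn => h'.not_onCycle_of_lt (hn.trans_le hle)]
    exact ttcRun_remaining_antitone hle h'.2.2.1
  · have hst := ttcRun_congr hQ m' (fun n hn => h.not_onCycle_of_lt (hn.trans hlt))
      fun n hn => h'.not_onCycle_of_lt hn
    obtain ⟨u, ⟨b, hb, hbu⟩, hus⟩ := TransGen.head'_iff.1 h'.1
    obtain rfl := h'.2.unique hb
    have hus' : ReflTransGen (Pb.Leads (Pb.target p q) master Q
        (Pb.ttcRun (Pb.target p q) master Q m')) u s := by
      rw [hst]
      refine reflTransGen_of_avoid (fun x y hx => ?_) hus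
      rintro ⟨a, ha, hay⟩
      exact ⟨a, by rwa [StudentPoints, hQ x hx], hay⟩
    rw [← hst] at hbu
    suffices H : ∀ n, m' ≤ n → n ≤ m →
        Pb.PairPoints (Pb.target p q) master (Pb.ttcRun (Pb.target p q) master Q n) a' u ∧
        ReflTransGen (Pb.Leads (Pb.target p q) master Q
          (Pb.ttcRun (Pb.target p q) master Q n)) u s from (H m hlt.le le_rfl).1.1
    intro n hn
    induction n, hn using Nat.le_induction with
    | base => exact fun _ => ⟨hbu, hus'⟩
    | succ n _ ih =>
      intro hnm
      obtain ⟨h₁, h₂⟩ := ih (Nat.le_of_succ_le hnm)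
      rw [ttcRun_succ]
      exact chain_ttcStep (sound_ttcRun h₀ n) (h.not_onCycle_of_lt hnm) h₁ h₂

lemma ttc_strategyProof (h₀ : Pb.SatisfiesGoal (schoolLevelPolicy p q) Pb.initial)
    (master : StrictRanking S) {hyp : S → Preference C → StrictRanking (C × T)}
    (hhyp : ∀ s P, Pb.IsHypothetical s P (hyp s P)) :
    Pb.StrategyProof (Pb.ttc (Pb.target p q) master hyp) := by
  classical
  intro P s P' hrel
  obtain ⟨ν, hν, -, htrade⟩ := exists_ttc_assigns h₀ master fun s => hhyp s (P s)
  obtain ⟨ν', hν', -, htrade'⟩ := exists_ttc_assigns h₀ master fun u =>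
    hhyp u (Function.update P s P' u)
  obtain ⟨m, hm⟩ := htrade s
  obtain ⟨m', hm'⟩ := htrade' s
  have hrem := remaining_of_tradesAt h₀ (fun u hu => by rw [Function.update_of_ne hu]) hm hm'
  have hrel' : (P s).rel (some (ν' s)) (some (ν s)) := by
    have e₁ := hν.outcome_eq s
    have e₂ := hν'.outcome_eq s
    rw [← e₁, ← e₂]
    exact hrel
  rw [(hhyp s (P s)).1] at hrel'
  refine (hyp s (P s)).asymm hrel' (hm.2.2.2 _ hrem fun h => ?_)
  rw [h] at hrel'
  exact (hyp s (P s)).irrefl _ hrel'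

end Run

end Problem

end SchoolChoice

theorem corollary2 {S D C T : Type*} [Fintype S] [Fintype D] [Fintype C] [Fintype T]
    (Pb : SchoolChoice.Problem S D C T) (p q : C → T → ℕ) :
    SchoolChoice.MConvex (SchoolChoice.schoolLevelPolicy p q ∩ Pb.fullMatchPolicy) ∧
    (Pb.SatisfiesGoal (SchoolChoice.schoolLevelPolicy p q) Pb.initial →
      ∀ (master : StrictRanking S)
        (hyp : S → SchoolChoice.Preference C → StrictRanking (C × T)),
        (∀ s P, Pb.IsHypothetical s P (hyp s P)) →
        Pb.IsMechanism
            (Pb.ttc (SchoolChoice.schoolLevelPolicy p q ∩ Pb.fullMatchPolicy) master hyp) ∧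
        (∀ P, Pb.SatisfiesGoal (SchoolChoice.schoolLevelPolicy p q)
            (Pb.ttc (SchoolChoice.schoolLevelPolicy p q ∩ Pb.fullMatchPolicy) master hyp P)) ∧
        (∀ P, Pb.ConstrainedEfficient (SchoolChoice.schoolLevelPolicy p q) P
            (Pb.ttc (SchoolChoice.schoolLevelPolicy p q ∩ Pb.fullMatchPolicy) master hyp P)) ∧
        (∀ P, Pb.IndividuallyRational P
            (Pb.ttc (SchoolChoice.schoolLevelPolicy p q ∩ Pb.fullMatchPolicy) master hyp P)) ∧
        Pb.StrategyProof
            (Pb.ttc (SchoolChoice.schoolLevelPolicy p q ∩ Pb.fullMatchPolicy) master hyp)) := by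
  refine ⟨SchoolChoice.Problem.mConvex_target, fun h₀ master hyp hhyp => ?_⟩
  have hout : ∀ P, Pb.SatisfiesGoal (SchoolChoice.schoolLevelPolicy p q)
      (Pb.ttc (Pb.target p q) master hyp P) ∧
      SchoolChoice.Feasible Pb.cap (Pb.ttc (Pb.target p q) master hyp P) := by
    intro P
    obtain ⟨ν, hν, hmem, -⟩ :=
      SchoolChoice.Problem.exists_ttc_assigns h₀ master fun s => hhyp s (P s)
    exact hν.mem_target_iff.1 hmem
  refine ⟨fun P => (hout P).2, fun P => (hout P).1, fun P => ⟨(hout P).2, (hout P).1, ?_⟩,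
    fun P => SchoolChoice.Problem.ttc_individuallyRational h₀ master fun s => hhyp s (P s),
    SchoolChoice.Problem.ttc_strategyProof h₀ master hhyp⟩
  rintro ⟨Y, hY, hYgoal, hdom⟩
  exact SchoolChoice.Problem.ttc_not_paretoDominated h₀ master (fun s => hhyp s (P s)) hY hYgoal
    hdom
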